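/- Fix $q\in(0,1)$ and let $E(x)=\sum_{n\ge 0}\frac{(-x)^n}{(1-q)(1-q^2)\cdots(1-q^n)}$ be the quantum exponential. For an integer $N\ge 2$ let $Q_N$ be the quiver with vertices $(i,j)$, $1\le i<j\le N$, and directed edges $(i,j)\to(i,j+1)$, $(i,j)\to(i+1,j)$, $(i+1,j+1)\to(i,j)$, whenever both ends are vertices, and let $B$ be its skew-symmetric incidence matrix ($B_{v,w}=-B_{w,v}=1$ if there is an edge from $v$ to $w$, and $B_{v,w}=0$ if $v,w$ are not connected). Let $\mathcal T_N$ be the unital associative real algebra with generators $Z_v$ ($v$ a vertex of $Q_N$) and defining relations $Z_vZ_w=q^{B_{v,w}}Z_wZ_v$, and let $\widehat{\mathcal T}_N$ be the algebra of formal series in the generators, i.e. the completion of $\mathcal T_N$ with respect to the powers of the ideal of elements without constant term. Let $\rho$ be the automorphism of $\mathcal T_N$ and of $\widehat{\mathcal T}_N$ with $\rho(Z_{ij})=Z_{j-i,\,N+1-i}$, and put $$T_N=\prod_{1\le a<b<c\le N+1}^{\rightarrow}E\bigl(Z_{a,b}\,Z_{a+1,b+1}\cdots Z_{a+c-b-1,\,c-1}\bigr)\in\widehat{\mathcal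 T}_N ,$$ where the factors are ordered from left to right by the lexicographic order of $(a,b,c)$. Write $T_N$, $\rho(T_N)$ and $\rho(\rho(T_N))$ as the corresponding ordered products of quantum exponentials of monomials in the generators. Let $I$ be any set of vertices of $Q_N$. In the identity $T_N=\rho(T_N)=\rho(\rho(T_N))$ replace with $1$ every quantum exponential whose argument contains at least one generator $Z_{ij}$ with $(i,j)\in I$. Then the resulting two equalities between the three reduced products hold in $\widehat{\mathcal T}_N$. For example, with $X=Z_{12}$, $Y=Z_{23}$, $Z=Z_{13}$ the identity for $N=3$ is the $4\sim4$ identity $$E(X)E(XY)E(Z)E(Y)=E(Z)E(ZX)E(Y)E(X)=E(Y)E(YZ)E(X)E(Z),$$ and for $I=\{(1,3)\}$ its three reduced products are $E(X)E(XY)E(Y)$, $E(Y)E(X)$ and $E(Y)E(X)$, where $YX=qXY$. In this way one obtains the pentagon identity $E(X)E(XY)E(Y)=E(Y)E(X)$, which holds for formal series in two indeterminates $X,Y$ subject only to $YX=qXY$. -/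

import Mathlib

namespace CyclicDilog

section General

/-- The defining relations `Z_v Z_w = q ^ (B v w) Z_w Z_v` attached to an integer matrix `B`
with rows and columns labelled by `V`. -/
inductive QRel {V : Type*} (q : ℝ) (B : V → V → ℤ) : FreeAlgebra ℝ V → FreeAlgebra ℝ V → Prop
  | comm (v w : V) : QRel q B (FreeAlgebra.ι ℝ v * FreeAlgebra.ι ℝ w)
      ((q ^ B v w : ℝ) • (FreeAlgebra.ι ℝ w * FreeAlgebra.ι ℝ v))

/-- The unital associative real algebra with generators `Z_v`, `v : V`, and defining relations
`Z_v Z_w = q ^ (B v w) Z_w Z_v`. -/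
def QAlg {V : Type*} (q : ℝ) (B : V → V → ℤ) : Type _ := RingQuot (QRel q B)

noncomputable instance instRingQAlg {V : Type*} (q : ℝ) (B : V → V → ℤ) : Ring (QAlg q B) :=
  inferInstanceAs (Ring (RingQuot (QRel q B)))

noncomputable instance instAlgebraQAlg {V : Type*} (q : ℝ) (B : V → V → ℤ) :
    Algebra ℝ (QAlg q B) :=
  inferInstanceAs (Algebra ℝ (RingQuot (QRel q B)))

/-- The quotient homomorphism from the free algebra. -/
noncomputable def ofFree {V : Type*} (q : ℝ) (B : V → V → ℤ) : FreeAlgebra ℝ V →ₐ[ℝ] QAlg q B :=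
  RingQuot.mkAlgHom ℝ (QRel q B)

/-- The universal property: a family of elements that satisfies the defining relations extends to
an algebra homomorphism. -/
noncomputable def liftQ {V : Type*} (q : ℝ) (B : V → V → ℤ) {A : Type*} [Ring A] [Algebra ℝ A]
    (f : V → A) (hf : ∀ v w, f v * f w = (q ^ B v w : ℝ) • (f w * f v)) : QAlg q B →ₐ[ℝ] A :=
  RingQuot.liftAlgHom ℝ (s := QRel q B) ⟨FreeAlgebra.lift ℝ f, by
    intro x y h
    cases h with
    | comm v w => simp [hf v w]⟩

/-- The generator `Z_v`. -/
noncomputable def gen {V : Type*} (q : ℝ) (B : V → V → ℤ) (v : V) : QAlg q B :=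
  ofFree q B (FreeAlgebra.ι ℝ v)

theorem liftQ_gen {V : Type*} (q : ℝ) (B : V → V → ℤ) {A : Type*} [Ring A] [Algebra ℝ A]
    (f : V → A) (hf : ∀ v w, f v * f w = (q ^ B v w : ℝ) • (f w * f v)) (v : V) :
    liftQ q B f hf (gen q B v) = f v :=
  (RingQuot.liftAlgHom_mkAlgHom_apply ℝ _ _ _).trans (FreeAlgebra.lift_ι_apply _ _)

theorem hom_ext {V : Type*} (q : ℝ) (B : V → V → ℤ) {A : Type*} [Ring A] [Algebra ℝ A]
    {f g : QAlg q B →ₐ[ℝ] A} (h : ∀ v, f (gen q B v) = g (gen q B v)) : f = g :=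
  RingQuot.ringQuot_ext' ℝ f g (FreeAlgebra.hom_ext (funext h))

theorem gen_mul_gen {V : Type*} (q : ℝ) (B : V → V → ℤ) (v w : V) :
    gen q B v * gen q B w = (q ^ B v w : ℝ) • (gen q B w * gen q B v) := by
  simp only [gen, ← map_mul, ← map_smul]
  exact RingQuot.mkAlgHom_rel ℝ (QRel.comm (q := q) (B := B) v w)

/-- The constant term: the algebra homomorphism to `ℝ` that sends every generator to `0`. -/
noncomputable def constTerm {V : Type*} (q : ℝ) (B : V → V → ℤ) : QAlg q B →ₐ[ℝ] ℝ :=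
  liftQ q B (fun _ => (0 : ℝ)) (by simp)

theorem constTerm_gen {V : Type*} (q : ℝ) (B : V → V → ℤ) (v : V) :
    constTerm q B (gen q B v) = 0 := by
  rw [constTerm, liftQ_gen]

/-- The two-sided ideal of the elements without constant term. -/
noncomputable def augIdeal {V : Type*} (q : ℝ) (B : V → V → ℤ) : Ideal (QAlg q B) :=
  RingHom.ker (constTerm q B)

instance augIdeal_isTwoSided {V : Type*} (q : ℝ) (B : V → V → ℤ) :
    (augIdeal q B).IsTwoSided :=
  inferInstanceAs (RingHom.ker (constTerm q B)).IsTwoSided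

theorem mem_augIdeal {V : Type*} {q : ℝ} {B : V → V → ℤ} {x : QAlg q B} :
    x ∈ augIdeal q B ↔ constTerm q B x = 0 := Iff.rfl

/-- The algebra of formal series in the generators `Z_v`: the completion of the algebra
with respect to the powers `J ^ n` of the ideal `J` of elements without constant term, that is,
the inverse limit of the quotients modulo `J ^ n`. -/
noncomputable def QSeries {V : Type*} (q : ℝ) (B : V → V → ℤ) :
    Subalgebra ℝ (∀ n : ℕ, QAlg q B ⧸ augIdeal q B ^ n) where
  carrier := {f | ∀ (m n : ℕ) (h : m ≤ n), Ideal.Quotient.factorPow (augIdeal q B) h (f n) = f m}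
  mul_mem' := by
    intro f g hf hg m n h
    simp only [Pi.mul_apply, map_mul, hf m n h, hg m n h]
  add_mem' := by
    intro f g hf hg m n h
    simp only [Pi.add_apply, map_add, hf m n h, hg m n h]
  algebraMap_mem' := by
    intro r m n h
    rfl

/-- The canonical homomorphism from the algebra to its completion. -/
noncomputable def toSeries {V : Type*} (q : ℝ) (B : V → V → ℤ) : QAlg q B →ₐ[ℝ] QSeries q B where
  toFun x := ⟨fun n => Ideal.Quotient.mk (augIdeal q B ^ n) x, fun _ _ _ => rfl⟩
  map_one' := rfl
  map_mul' _ _ := rfl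
  map_zero' := rfl
  map_add' _ _ := rfl
  commutes' _ := rfl

/-- The partial sum, over `k < n`, of the quantum exponential series
`∑ k, (-x) ^ k / ((1 - q) ⋯ (1 - q ^ k))`. -/
noncomputable def qExpPartial {V : Type*} {q : ℝ} {B : V → V → ℤ} (x : QAlg q B) (n : ℕ) :
    QAlg q B :=
  ∑ k ∈ Finset.range n, (∏ m ∈ Finset.Icc 1 k, (1 - q ^ m))⁻¹ • (-x) ^ k

theorem qExpPartial_compat {V : Type*} {q : ℝ} {B : V → V → ℤ} {x : QAlg q B}
    (hx : x ∈ augIdeal q B) (m n : ℕ) (h : m ≤ n) :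
    Ideal.Quotient.mk (augIdeal q B ^ m) (qExpPartial x n) =
      Ideal.Quotient.mk (augIdeal q B ^ m) (qExpPartial x m) := by
  rw [Ideal.Quotient.eq, qExpPartial, qExpPartial,
    ← Finset.sum_range_add_sum_Ico _ h, add_sub_cancel_left]
  refine Ideal.sum_mem _ fun k hk => ?_
  rw [Algebra.smul_def]
  refine Ideal.mul_mem_left _ _ ?_
  exact Ideal.pow_le_pow_right (Finset.mem_Ico.mp hk).1
    (Ideal.pow_mem_pow (neg_mem hx) k)

open Classical in
/-- The quantum exponential `E(x) = ∑ k, (-x) ^ k / ((1 - q) ⋯ (1 - q ^ k))` of an element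
without constant term, a formal series (the value for other elements, where the series has no
meaning, is `1` by convention). -/
noncomputable def qExp {V : Type*} {q : ℝ} {B : V → V → ℤ} (x : QAlg q B) : QSeries q B :=
  if hx : x ∈ augIdeal q B then
    ⟨fun n => Ideal.Quotient.mk (augIdeal q B ^ n) (qExpPartial x n),
      fun m n h => qExpPartial_compat hx m n h⟩
  else 1

/-- The endomorphism `Z_v ↦ Z_{φ v}` induced by a map `φ` of the labels that preserves `B`. -/
noncomputable def relabel {V : Type*} (q : ℝ) (B : V → V → ℤ) (φ : V → V)
    (hφ : ∀ v w, B (φ v) (φ w) = B v w) : QAlg q B →ₐ[ℝ] QAlg q B :=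
  liftQ q B (fun v => gen q B (φ v)) (fun v w => by rw [gen_mul_gen, hφ])

theorem relabel_gen {V : Type*} (q : ℝ) (B : V → V → ℤ) (φ : V → V)
    (hφ : ∀ v w, B (φ v) (φ w) = B v w) (v : V) :
    relabel q B φ hφ (gen q B v) = gen q B (φ v) := by
  rw [relabel, liftQ_gen]

theorem constTerm_relabel {V : Type*} (q : ℝ) (B : V → V → ℤ) (φ : V → V)
    (hφ : ∀ v w, B (φ v) (φ w) = B v w) (x : QAlg q B) :
    constTerm q B (relabel q B φ hφ x) = constTerm q B x := by
  have h : (constTerm q B).comp (relabel q B φ hφ) = constTerm q B := by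
    refine hom_ext q B fun v => ?_
    rw [AlgHom.comp_apply, relabel_gen, constTerm_gen, constTerm_gen]
  exact DFunLike.congr_fun h x

theorem augIdeal_pow_le_comap {V : Type*} (q : ℝ) (B : V → V → ℤ) (φ : V → V)
    (hφ : ∀ v w, B (φ v) (φ w) = B v w) (n : ℕ) :
    augIdeal q B ^ n ≤ (augIdeal q B ^ n).comap (relabel q B φ hφ) := by
  induction n with
  | zero =>
    intro x _
    simp [Submodule.pow_zero]
  | succ n ih =>
    rw [Submodule.pow_succ, Ideal.mul_le]
    intro x hx y hy
    rw [Ideal.mem_comap, map_mul]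
    refine Ideal.mul_mem_mul (ih hx) ?_
    rw [mem_augIdeal, constTerm_relabel]
    exact hy

/-- The extension of `relabel` to formal series. -/
noncomputable def relabelSeries {V : Type*} (q : ℝ) (B : V → V → ℤ) (φ : V → V)
    (hφ : ∀ v w, B (φ v) (φ w) = B v w) : QSeries q B →ₐ[ℝ] QSeries q B where
  toFun f := ⟨fun n => Ideal.quotientMapₐ (augIdeal q B ^ n) (relabel q B φ hφ)
      (augIdeal_pow_le_comap q B φ hφ n) (f.1 n), by
    intro m n h
    change _ = Ideal.quotientMapₐ _ _ _ (f.1 m)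
    rw [← f.2 m n h]
    change _ = Ideal.quotientMapₐ _ _ _ (Ideal.Quotient.factorPow _ h (f.1 n))
    change Ideal.Quotient.factorPow _ h (Ideal.quotientMapₐ _ _ _ (f.1 n)) = _
    generalize f.1 n = g
    obtain ⟨a, rfl⟩ := Ideal.Quotient.mk_surjective g
    rfl⟩
  map_one' := Subtype.ext (funext fun _ => map_one _)
  map_mul' _ _ := Subtype.ext (funext fun _ => map_mul _ _ _)
  map_zero' := Subtype.ext (funext fun _ => map_zero _)
  map_add' _ _ := Subtype.ext (funext fun _ => map_add _ _ _)
  commutes' _ := Subtype.ext (funext fun _ => AlgHom.commutes _ _)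

theorem relabelSeries_toSeries {V : Type*} (q : ℝ) (B : V → V → ℤ) (φ : V → V)
    (hφ : ∀ v w, B (φ v) (φ w) = B v w) (x : QAlg q B) :
    relabelSeries q B φ hφ (toSeries q B x) = toSeries q B (relabel q B φ hφ x) := rfl

theorem relabelSeries_qExp {V : Type*} (q : ℝ) (B : V → V → ℤ) (φ : V → V)
    (hφ : ∀ v w, B (φ v) (φ w) = B v w) (x : QAlg q B) :
    relabelSeries q B φ hφ (qExp x) = qExp (relabel q B φ hφ x) := by
  by_cases hx : x ∈ augIdeal q B
  · have hx' : relabel q B φ hφ x ∈ augIdeal q B := by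
      rw [mem_augIdeal, constTerm_relabel]; exact hx
    rw [qExp, dif_pos hx, qExp, dif_pos hx']
    refine Subtype.ext (funext fun n => ?_)
    change Ideal.Quotient.mk _ (relabel q B φ hφ (qExpPartial x n)) = _
    congr 1
    simp [qExpPartial, map_sum]
  · have hx' : relabel q B φ hφ x ∉ augIdeal q B := by
      rw [mem_augIdeal, constTerm_relabel]; exact hx
    rw [qExp, dif_neg hx, qExp, dif_neg hx', map_one]

end General

/-- The vertices `(i, j)`, `1 ≤ i < j ≤ N`, of the triangular quiver `Q_N`. -/
abbrev Vertex (N : ℕ) : Type := {v : ℕ × ℕ // 1 ≤ v.1 ∧ v.1 < v.2 ∧ v.2 ≤ N}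

/-- There is a directed edge of `Q_N` from `v` to `w`: the edges go from `(i, j)` to `(i, j + 1)`,
from `(i, j)` to `(i + 1, j)` and from `(i + 1, j + 1)` to `(i, j)`. -/
def Edge {N : ℕ} (v w : Vertex N) : Prop :=
  w.1 = (v.1.1, v.1.2 + 1) ∨ w.1 = (v.1.1 + 1, v.1.2) ∨ v.1 = (w.1.1 + 1, w.1.2 + 1)

instance decidableEdge {N : ℕ} (v w : Vertex N) : Decidable (Edge v w) :=
  inferInstanceAs (Decidable (_ ∨ _ ∨ _))

/-- The skew-symmetric incidence matrix of `Q_N`. -/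
def incidence (N : ℕ) (v w : Vertex N) : ℤ :=
  if Edge v w then 1 else if Edge w v then -1 else 0

/-- The rotation `(i, j) ↦ (j - i, N + 1 - i)` of the vertices of `Q_N`. -/
def rotVertex {N : ℕ} (v : Vertex N) : Vertex N :=
  ⟨(v.1.2 - v.1.1, N + 1 - v.1.1), by have := v.2; omega, by have := v.2; omega,
    by have := v.2; omega⟩

theorem edge_rotVertex {N : ℕ} (v w : Vertex N) : Edge (rotVertex v) (rotVertex w) ↔ Edge v w := by
  obtain ⟨⟨i, j⟩, h⟩ := v
  obtain ⟨⟨k, l⟩, h'⟩ := w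
  simp only [Edge, rotVertex, Prod.mk.injEq] at *
  omega

theorem incidence_rotVertex {N : ℕ} (v w : Vertex N) :
    incidence N (rotVertex v) (rotVertex w) = incidence N v w := by
  unfold incidence
  exact if_congr (edge_rotVertex v w) rfl (if_congr (edge_rotVertex w v) rfl rfl)

/-- The algebra `𝒯_N` of the quiver `Q_N`. -/
abbrev TAlg (q : ℝ) (N : ℕ) : Type := QAlg q (incidence N)

/-- The algebra of formal series in the generators of `𝒯_N`. -/
abbrev TSeries (q : ℝ) (N : ℕ) : Type := QSeries q (incidence N)

/-- The generator `Z_{ij}` of `𝒯_N`. -/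
noncomputable def Z (q : ℝ) {N : ℕ} (v : Vertex N) : TAlg q N := gen q (incidence N) v

/-- The automorphism `ρ` of the algebra of formal series,
`ρ(Z_{ij}) = Z_{j - i, N + 1 - i}`. -/
noncomputable def rho (q : ℝ) (N : ℕ) : TSeries q N →ₐ[ℝ] TSeries q N :=
  relabelSeries q (incidence N) rotVertex incidence_rotVertex

theorem rho_Z (q : ℝ) {N : ℕ} (v : Vertex N) :
    rho q N (toSeries q (incidence N) (Z q v)) = toSeries q (incidence N) (Z q (rotVertex v)) := by
  rw [rho, relabelSeries_toSeries, Z, relabel_gen, Z]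

/-- The points `(a, b, c)`, `1 ≤ a < b < c ≤ N + 1`, of the discrete tetrahedron `Λ_N`. -/
abbrev Tetra (N : ℕ) : Type :=
  {t : ℕ × ℕ × ℕ // 1 ≤ t.1 ∧ t.1 < t.2.1 ∧ t.2.1 < t.2.2 ∧ t.2.2 ≤ N + 1}

/-- The points of `Λ_N` listed in the lexicographic order. -/
def tetraList (N : ℕ) : List (Tetra N) :=
  ((List.range (N + 2)) ×ˢ ((List.range (N + 2)) ×ˢ (List.range (N + 2)))).filterMap
    fun t => if h : 1 ≤ t.1 ∧ t.1 < t.2.1 ∧ t.2.1 < t.2.2 ∧ t.2.2 ≤ N + 1 then some ⟨t, h⟩ else none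

/-- The vertices `(a, b), (a + 1, b + 1), …, (a + c - b - 1, c - 1)` attached to a point
`(a, b, c)` of `Λ_N`. -/
def diag {N : ℕ} (t : Tetra N) : List (Vertex N) :=
  (List.finRange (t.1.2.2 - t.1.2.1)).map fun k : Fin (t.1.2.2 - t.1.2.1) =>
    ⟨(t.1.1 + k, t.1.2.1 + k), by have := t.2; omega, by have := t.2; omega,
      by have := t.2; have := k.2; omega⟩

/-- The element `⟦λ⟧ = E(Z_{a,b} Z_{a+1,b+1} ⋯ Z_{a+c-b-1,c-1})` for a point `λ = (a, b, c)`
of `Λ_N`. -/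
noncomputable def dil (q : ℝ) {N : ℕ} (t : Tetra N) : TSeries q N :=
  qExp ((diag t).map (Z q)).prod

/-- The element `T_N`, the lexicographically ordered product of all `⟦λ⟧`. -/
noncomputable def cyclicT (q : ℝ) (N : ℕ) : TSeries q N := ((tetraList N).map (dil q)).prod

open Classical in
/-- The expression `ρ^m(T_N) = ∏ ρ^m(⟦λ⟧)` in which every quantum exponential `ρ^m(⟦λ⟧)` that
contains at least one generator `Z_v` with `v ∈ I` is replaced with `1`. As `ρ` maps `Z_v` to
the generator at the rotated vertex, the generators contained in `ρ^m(⟦λ⟧)` are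
those at the vertices of `diag λ` rotated `m` times. -/
noncomputable def reducedT (q : ℝ) {N : ℕ} (I : Set (Vertex N)) (m : ℕ) : TSeries q N :=
  ((tetraList N).map fun t =>
    if ∃ v ∈ diag t, rotVertex^[m] v ∈ I then 1 else (rho q N)^[m] (dil q t)).prod

theorem reducedT_empty (q : ℝ) (N m : ℕ) :
    reducedT q (∅ : Set (Vertex N)) m = (rho q N)^[m] (cyclicT q N) := by
  induction m with
  | zero => simp [reducedT, cyclicT]
  | succ m ih =>
    rw [Function.iterate_succ_apply', ← ih, reducedT, reducedT, map_list_prod, List.map_map]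
    simp [Function.iterate_succ_apply', Function.comp_def]

/-- The vertices of `Q_3`. -/
def v12 : Vertex 3 := ⟨(1, 2), by decide⟩

/-- See `v12`. -/
def v13 : Vertex 3 := ⟨(1, 3), by decide⟩

/-- See `v12`. -/
def v23 : Vertex 3 := ⟨(2, 3), by decide⟩

/-- The matrix whose algebra has two generators `X = Z_0` and `Y = Z_1` with the
relation `Y X = q X Y`. -/
def planeMatrix : Fin 2 → Fin 2 → ℤ := ![![0, -1], ![1, 0]]

end CyclicDilog

open CyclicDilog

/-! The reductions follow from the single identity `rho_cyclicT`, ρ(T_N) = T_N. Sending Z_v to 0 for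
v ∈ I respects the q-commutation relations and the constant term, so it extends to formal series
(`killGens`, `mapSeries`). It turns E of a monomial that contains a killed generator into E(0) = 1
and fixes the other factors. Applied to ρ^m(T_N) = T_N, it gives the reduced identities
(`reducedT_eq_mapSeries`).

For ρ(T_N) = T_N, put Z_{x+1,x+y+2} at the point (x, y) of a triangle. The factors of T_N are then E
of horizontal segments (`row`), and those of ρ(T_N) are E of vertical segments hanging from
hypotenuses of shrinking triangles (`col`). It suffices to peel off one hypotenuse: all rows of the
triangle of size n equal the columns that end on its hypotenuse times all rows of the triangle of
size n - 1 (`rowProd_eq`).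

A row that reaches the hypotenuse is a degenerate hook: a row followed by the column above its end.
When a shorter row passes through the ordered product of columns, one pentagon creates a hook with a
shorter horizontal part and a second pentagon absorbs the old hook (`row_mul_withHook`). After all
shorter rows have passed, the hook has become a column and the shorter rows survive unchanged. These
moves need only the pentagon identity (`qExp_pentagon`) and the q-commutation exponents of rows and
columns (`row_isQComm_col`). -/

namespace CyclicDilog

/-! ### Coefficients of the quantum exponential -/

/-- The coefficient `1 / ((1 - q) ⋯ (1 - q ^ k))` of the quantum exponential. -/
noncomputable def qCoeff (q : ℝ) (k : ℕ) : ℝ := (∏ m ∈ Finset.Icc 1 k, (1 - q ^ m))⁻¹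

theorem qCoeff_zero (q : ℝ) : qCoeff q 0 = 1 := by simp [qCoeff]

theorem one_sub_pow_ne_zero {q : ℝ} (hq0 : 0 < q) (hq1 : q < 1) (k : ℕ) : 1 - q ^ (k + 1) ≠ 0 :=
  (sub_pos.mpr (pow_lt_one₀ hq0.le hq1 k.succ_ne_zero)).ne'

theorem qCoeff_succ {q : ℝ} (hq0 : 0 < q) (hq1 : q < 1) (k : ℕ) :
    (1 - q ^ (k + 1)) * qCoeff q (k + 1) = qCoeff q k := by
  rw [qCoeff, qCoeff, Finset.prod_Icc_succ_top (by omega), mul_inv, mul_comm, mul_assoc,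
    inv_mul_cancel₀ (one_sub_pow_ne_zero hq0 hq1 k), mul_one]

/-- The coefficient of `x ^ m` in `x ^ k ∑ i, x ^ i / ((1 - q) ⋯ (1 - q ^ i))`. -/
noncomputable def shiftCoeff (q : ℝ) (k m : ℕ) : ℝ := if k ≤ m then qCoeff q (m - k) else 0

theorem shiftCoeff_succ {q : ℝ} (hq0 : 0 < q) (hq1 : q < 1) (k m : ℕ) :
    q ^ k * shiftCoeff q (k + 1) m = (q ^ k - q ^ m) * shiftCoeff q k m := by
  unfold shiftCoeff
  rcases lt_trichotomy k m with h | rfl | h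
  · obtain ⟨d, rfl⟩ := Nat.exists_eq_add_of_lt h
    rw [if_pos (by omega), if_pos (by omega), show k + d + 1 - (k + 1) = d by omega,
      show k + d + 1 - k = d + 1 by omega, ← qCoeff_succ hq0 hq1 d]
    ring
  · simp
  · rw [if_neg (by omega), if_neg (by omega)]; ring

theorem shiftCoeff_succ_succ {q : ℝ} (k m : ℕ) :
    shiftCoeff q (k + 1) (m + 1) = shiftCoeff q k m := by
  simp [shiftCoeff]

/-- This is the pentagon identity read off at x^m y^n, up to the common sign. Terms with k > n
vanish, so the cutoff K is immaterial; leaving it free lets the induction on n shorten the range. -/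
theorem sum_qCoeff {q : ℝ} (hq0 : 0 < q) (hq1 : q < 1) (m n K : ℕ) (hK : n < K) :
    ∑ k ∈ Finset.range K, (-1) ^ k * q ^ (k.choose 2) * qCoeff q k * shiftCoeff q k m *
      shiftCoeff q k n = q ^ (m * n) * qCoeff q m * qCoeff q n := by
  induction n generalizing K with
  | zero =>
    rw [Finset.sum_eq_single_of_mem 0 (by simpa using hK)]
    · simp [shiftCoeff, qCoeff_zero]
    · intro k _ hk
      rw [shiftCoeff, shiftCoeff, if_neg (show ¬ k ≤ 0 by omega)]; ring
  | succ n ih =>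
    obtain ⟨K, rfl⟩ : ∃ L, K = L + 1 := ⟨K - 1, by omega⟩
    refine mul_left_cancel₀ (one_sub_pow_ne_zero hq0 hq1 n) ?_
    have e : (1 - q ^ (n + 1)) * (q ^ (m * (n + 1)) * qCoeff q m * qCoeff q (n + 1)) =
        q ^ m * (q ^ (m * n) * qCoeff q m * qCoeff q n) := by
      rw [← qCoeff_succ hq0 hq1 n]; ring
    rw [e, ← ih K (by omega), Finset.mul_sum, Finset.mul_sum]
    -- Write 1 - q^(n+1) = (1 - q^k) + (q^k - q^(n+1)). The first part kills k = 0 and is reindexed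
    -- by k + 1; the second raises the shift. Recombined, the two sums give q^m times the sum for n.
    have split : ∀ k, (1 - q ^ (n + 1)) * ((-1) ^ k * q ^ (k.choose 2) * qCoeff q k *
        shiftCoeff q k m * shiftCoeff q k (n + 1)) =
        (-1) ^ k * q ^ (k.choose 2) * (1 - q ^ k) * qCoeff q k * shiftCoeff q k m *
          shiftCoeff q k (n + 1) +
        (-1) ^ k * q ^ (k.choose 2) * qCoeff q k * shiftCoeff q k m *
          (q ^ k * shiftCoeff q (k + 1) (n + 1)) := by
      intro k
      rw [shiftCoeff_succ hq0 hq1 k (n + 1)]; ring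
    rw [Finset.sum_congr rfl fun k _ => split k, Finset.sum_add_distrib, Finset.sum_range_succ']
    rw [Finset.sum_range_succ _ K]
    have last : shiftCoeff q (K + 1) (n + 1) = 0 := by
      rw [shiftCoeff, if_neg (by omega)]
    rw [last]
    simp only [pow_zero, sub_self, mul_zero, zero_mul, add_zero]
    rw [← Finset.sum_add_distrib]
    refine Finset.sum_congr rfl fun k _ => ?_
    have hc : (k + 1).choose 2 = k.choose 2 + k := by
      rw [Nat.choose_succ_succ' k 1, Nat.choose_one_right, add_comm]
    rw [shiftCoeff_succ_succ, mul_assoc _ (1 - q ^ (k + 1)), qCoeff_succ hq0 hq1, hc, pow_add q]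
    have h := shiftCoeff_succ hq0 hq1 k m
    linear_combination (-(-1 : ℝ) ^ k * q ^ k.choose 2 * qCoeff q k * shiftCoeff q k n) * h

/-- The truncated quantum exponential. -/
noncomputable def truncExp {R : Type*} [Ring R] [Algebra ℝ R] (q : ℝ) (x : R) (n : ℕ) : R :=
  ∑ k ∈ Finset.range n, qCoeff q k • (-x) ^ k

theorem Commute.truncExp {R : Type*} [Ring R] [Algebra ℝ R] {q : ℝ} {x y : R} (h : Commute x y)
    (m n : ℕ) : Commute (truncExp q x m) (truncExp q y n) := by
  refine Commute.sum_left _ _ _ fun i _ => Commute.sum_right _ _ _ fun j _ => ?_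
  exact ((h.neg_left.neg_right.pow_pow i j).smul_left _).smul_right _

/-! ### Pentagon identity for nilpotent q-commuting elements -/

section Pentagon

variable {R : Type*} [Ring R] [Algebra ℝ R] {q : ℝ} {x y : R}

theorem pow_mul_of_qcomm (h : y * x = q • (x * y)) (n : ℕ) :
    y ^ n * x = q ^ n • (x * y ^ n) := by
  induction n with
  | zero => simp
  | succ n ih =>
    rw [pow_succ', mul_assoc, ih, mul_smul_comm, ← mul_assoc, h, smul_mul_assoc, smul_smul,
      mul_assoc, pow_succ]

theorem pow_mul_pow_of_qcomm (h : y * x = q • (x * y)) (m n : ℕ) :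
    y ^ n * x ^ m = q ^ (m * n) • (x ^ m * y ^ n) := by
  induction m with
  | zero => simp
  | succ m ih =>
    rw [pow_succ, ← mul_assoc, ih, smul_mul_assoc, mul_assoc, pow_mul_of_qcomm h, mul_smul_comm,
      smul_smul, ← mul_assoc, ← pow_add]
    congr 2; ring

theorem mul_pow_of_qcomm (h : y * x = q • (x * y)) (k : ℕ) :
    (x * y) ^ k = q ^ (k.choose 2) • (x ^ k * y ^ k) := by
  induction k with
  | zero => simp
  | succ k ih =>
    rw [pow_succ, ih, smul_mul_assoc, mul_assoc, ← mul_assoc (y ^ k), pow_mul_of_qcomm h,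
      smul_mul_assoc, mul_smul_comm, smul_smul, ← pow_add, pow_succ x, pow_succ y,
      Nat.choose_succ_succ' k 1, Nat.choose_one_right, add_comm k]
    simp only [mul_assoc]

/-- Multiplication by x^k shifts the exponents; nilpotency discards those that leave the range, so
the truncation order stays n. -/
theorem sum_shift_left (hx : x ^ n = 0) (k : ℕ) :
    x ^ k * ∑ i ∈ Finset.range n, qCoeff q i • (-x) ^ i =
      ∑ m ∈ Finset.range n, ((-1) ^ k * (-1) ^ m * shiftCoeff q k m) • x ^ m := by
  have hz : ∀ m, n ≤ m → x ^ m = 0 := fun m hm => pow_eq_zero_of_le hm hx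
  have e : x ^ k * ∑ i ∈ Finset.range n, qCoeff q i • (-x) ^ i =
      ∑ m ∈ Finset.range (n + k), ((-1) ^ k * (-1) ^ m * shiftCoeff q k m) • x ^ m := by
    rw [add_comm, Finset.sum_range_add, Finset.sum_eq_zero (s := Finset.range k), zero_add,
      Finset.mul_sum]
    · refine Finset.sum_congr rfl fun i _ => ?_
      have h1 : (-x) ^ i = ((-1 : ℝ) ^ i) • x ^ i := by
        rw [← neg_one_smul ℝ x, smul_pow]
      rw [h1, mul_smul_comm, mul_smul_comm, ← pow_add, smul_smul, shiftCoeff, if_pos (by omega),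
        Nat.add_sub_cancel_left, pow_add (-1 : ℝ), ← mul_assoc ((-1 : ℝ) ^ k), ← mul_pow]
      simp [mul_comm]
    · intro i hi
      rw [shiftCoeff, if_neg (by simpa using hi), mul_zero, zero_smul]
  rw [e, Finset.sum_range_add, Finset.sum_eq_zero (s := Finset.range k), add_zero]
  intro i _
  rw [hz _ (by omega), smul_zero]

/-- Expand only the middle exponential: (xy)^k is a power of q times x^k y^k, and x^k moves left
past the exponential of x. Both sides become combinations of x^a y^b, whose coefficients agree by
`sum_qCoeff`. -/
theorem truncExp_pentagon (hq0 : 0 < q) (hq1 : q < 1) {n : ℕ} (hx : x ^ n = 0) (hy : y ^ n = 0)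
    (h : y * x = q • (x * y)) :
    truncExp q x n * truncExp q (x * y) n * truncExp q y n = truncExp q y n * truncExp q x n := by
  have hc : ∀ k, truncExp q x n * x ^ k = x ^ k * truncExp q x n := fun k =>
    (Commute.sum_left _ _ _ fun i _ =>
      (((Commute.refl x).neg_left.pow_pow i k).smul_left _)).eq
  have neg_pow' : ∀ (z : R) (i : ℕ), (-z) ^ i = ((-1 : ℝ) ^ i) • z ^ i := fun z i => by
    rw [← neg_one_smul ℝ z, smul_pow]
  have lhs : truncExp q x n * truncExp q (x * y) n * truncExp q y n =
      ∑ k ∈ Finset.range n, (qCoeff q k * ((-1) ^ k * q ^ (k.choose 2))) •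
        ((x ^ k * truncExp q x n) * (y ^ k * truncExp q y n)) := by
    rw [truncExp.eq_def q (x * y), Finset.mul_sum, Finset.sum_mul]
    refine Finset.sum_congr rfl fun k _ => ?_
    rw [neg_pow', mul_pow_of_qcomm h, smul_smul, smul_smul, mul_smul_comm, smul_mul_assoc,
      ← mul_assoc, hc, mul_assoc]
    simp only [mul_assoc]
  rw [lhs]
  have rhs : truncExp q y n * truncExp q x n =
      ∑ a ∈ Finset.range n, ∑ b ∈ Finset.range n,
        ((-1) ^ a * (-1) ^ b * (q ^ (a * b) * qCoeff q a * qCoeff q b)) • (x ^ a * y ^ b) := by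
    rw [truncExp, truncExp, Finset.sum_mul_sum, Finset.sum_comm]
    refine Finset.sum_congr rfl fun a _ => Finset.sum_congr rfl fun b _ => ?_
    rw [neg_pow', neg_pow', smul_smul, smul_smul, smul_mul_smul_comm, pow_mul_pow_of_qcomm h,
      smul_smul]
    congr 1; ring
  rw [rhs]
  have mid : ∀ k, (x ^ k * truncExp q x n) * (y ^ k * truncExp q y n) =
      ∑ a ∈ Finset.range n, ∑ b ∈ Finset.range n,
        ((-1) ^ a * (-1) ^ b * (shiftCoeff q k a * shiftCoeff q k b)) • (x ^ a * y ^ b) := by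
    intro k
    rw [truncExp, truncExp, sum_shift_left hx, sum_shift_left hy, Finset.sum_mul_sum]
    refine Finset.sum_congr rfl fun a _ => Finset.sum_congr rfl fun b _ => ?_
    rw [smul_mul_smul_comm]
    congr 1
    have : ((-1 : ℝ) ^ k) * (-1) ^ k = 1 := by rw [← mul_pow]; simp
    linear_combination ((-1) ^ a * (-1) ^ b * (shiftCoeff q k a * shiftCoeff q k b)) * this
  simp only [mid, Finset.smul_sum]
  rw [Finset.sum_comm]
  refine Finset.sum_congr rfl fun a _ => ?_
  rw [Finset.sum_comm]
  refine Finset.sum_congr rfl fun b hb => ?_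
  simp only [smul_smul]
  rw [← Finset.sum_smul, ← sum_qCoeff hq0 hq1 a b n (Finset.mem_range.mp hb), Finset.mul_sum]
  congr 1
  exact Finset.sum_congr rfl fun k _ => by ring

end Pentagon

/-! ### Quantum exponentials in the completion -/

section Series

variable {V : Type*} {q : ℝ} {B : V → V → ℤ}

theorem qExp_apply {x : QAlg q B} (hx : x ∈ augIdeal q B) (n : ℕ) :
    (qExp x).1 n = truncExp q (Ideal.Quotient.mk (augIdeal q B ^ n) x) n := by
  rw [qExp, dif_pos hx]
  change Ideal.Quotient.mkₐ ℝ (augIdeal q B ^ n) _ = truncExp q (Ideal.Quotient.mkₐ ℝ _ x) n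
  simp only [qExpPartial, truncExp, map_sum, map_smul, map_pow, map_neg, qCoeff]

theorem qExp_of_notMem {x : QAlg q B} (hx : x ∉ augIdeal q B) : qExp x = 1 := by
  rw [qExp, dif_neg hx]

theorem qExp_zero : qExp (0 : QAlg q B) = 1 := by
  refine Subtype.ext (funext fun n => ?_)
  rw [qExp_apply (zero_mem _)]
  cases n with
  | zero =>
    -- At level 0 the truncated exponential is the empty sum 0, which equals 1 only because the
    -- quotient is trivial.
    have : Subsingleton (QAlg q B ⧸ augIdeal q B ^ 0) :=
      Ideal.Quotient.subsingleton_iff.mpr (by simp [Submodule.pow_zero, Ideal.one_eq_top])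
    exact Subsingleton.elim _ _
  | succ n =>
    rw [truncExp, Finset.sum_range_succ']
    simp [qCoeff_zero]

theorem commute_qExp {x y : QAlg q B} (h : Commute x y) : Commute (qExp x) (qExp y) := by
  by_cases hx : x ∈ augIdeal q B
  · by_cases hy : y ∈ augIdeal q B
    · refine Subtype.ext (funext fun n => ?_)
      change (qExp x).1 n * (qExp y).1 n = (qExp y).1 n * (qExp x).1 n
      rw [qExp_apply hx, qExp_apply hy]
      exact (Commute.truncExp (h.map (Ideal.Quotient.mk (augIdeal q B ^ n))) n n).eq
    · rw [qExp_of_notMem hy]; exact Commute.one_right _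
  · rw [qExp_of_notMem hx]; exact Commute.one_left _

/-- The pentagon identity for two `q`-commuting elements without constant term. -/
theorem qExp_pentagon (hq0 : 0 < q) (hq1 : q < 1) {x y : QAlg q B} (hx : x ∈ augIdeal q B)
    (hy : y ∈ augIdeal q B) (h : y * x = q • (x * y)) :
    qExp x * qExp (x * y) * qExp y = qExp y * qExp x := by
  refine Subtype.ext (funext fun n => ?_)
  change (qExp x).1 n * (qExp (x * y)).1 n * (qExp y).1 n = (qExp y).1 n * (qExp x).1 n
  rw [qExp_apply hx, qExp_apply hy, qExp_apply (Ideal.mul_mem_left _ _ hy), map_mul]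
  have nil : ∀ z ∈ augIdeal q B, Ideal.Quotient.mk (augIdeal q B ^ n) z ^ n = 0 := fun z hz => by
    rw [← map_pow, Ideal.Quotient.eq_zero_iff_mem]
    exact Ideal.pow_mem_pow hz n
  refine truncExp_pentagon hq0 hq1 (nil x hx) (nil y hy) ?_
  have := congrArg (Ideal.Quotient.mkₐ ℝ (augIdeal q B ^ n)) h
  rw [map_smul, map_mul, map_mul] at this
  exact this

variable {V' : Type*} {B' : V' → V' → ℤ}

theorem augIdeal_pow_le_comap_of_constTerm (φ : QAlg q B →ₐ[ℝ] QAlg q B')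
    (hφ : ∀ x, constTerm q B' (φ x) = constTerm q B x) (n : ℕ) :
    augIdeal q B ^ n ≤ (augIdeal q B' ^ n).comap φ := by
  induction n with
  | zero =>
    intro x _
    simp [Submodule.pow_zero]
  | succ n ih =>
    rw [Submodule.pow_succ, Ideal.mul_le]
    intro x hx y hy
    rw [Ideal.mem_comap, map_mul]
    refine Ideal.mul_mem_mul (ih hx) ?_
    rw [mem_augIdeal, hφ]
    exact hy

/-- The extension to formal series of an algebra homomorphism that preserves constant terms. -/
noncomputable def mapSeries (φ : QAlg q B →ₐ[ℝ] QAlg q B')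
    (hφ : ∀ x, constTerm q B' (φ x) = constTerm q B x) : QSeries q B →ₐ[ℝ] QSeries q B' where
  toFun f := ⟨fun n => Ideal.quotientMapₐ (augIdeal q B' ^ n) φ
      (augIdeal_pow_le_comap_of_constTerm φ hφ n) (f.1 n), by
    intro m n h
    change _ = Ideal.quotientMapₐ _ _ _ (f.1 m)
    rw [← f.2 m n h]
    change Ideal.Quotient.factorPow _ h (Ideal.quotientMapₐ _ _ _ (f.1 n)) =
      Ideal.quotientMapₐ _ _ _ (Ideal.Quotient.factorPow _ h (f.1 n))
    generalize f.1 n = g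
    obtain ⟨a, rfl⟩ := Ideal.Quotient.mk_surjective g
    rfl⟩
  map_one' := Subtype.ext (funext fun _ => map_one _)
  map_mul' _ _ := Subtype.ext (funext fun _ => map_mul _ _ _)
  map_zero' := Subtype.ext (funext fun _ => map_zero _)
  map_add' _ _ := Subtype.ext (funext fun _ => map_add _ _ _)
  commutes' _ := Subtype.ext (funext fun _ => AlgHom.commutes _ _)

theorem mapSeries_qExp (φ : QAlg q B →ₐ[ℝ] QAlg q B')
    (hφ : ∀ x, constTerm q B' (φ x) = constTerm q B x) (x : QAlg q B) :
    mapSeries φ hφ (qExp x) = qExp (φ x) := by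
  by_cases hx : x ∈ augIdeal q B
  · have hx' : φ x ∈ augIdeal q B' := by rw [mem_augIdeal, hφ]; exact hx
    rw [qExp, dif_pos hx, qExp, dif_pos hx']
    refine Subtype.ext (funext fun n => ?_)
    change Ideal.Quotient.mk _ (φ (qExpPartial x n)) = _
    congr 1
    simp [qExpPartial, map_sum]
  · have hx' : φ x ∉ augIdeal q B' := by rw [mem_augIdeal, hφ]; exact hx
    rw [qExp_of_notMem hx, qExp_of_notMem hx', map_one]

end Series


/-! ### Ordered products in a monoid -/

section OrderedProducts

variable {M : Type*} [Monoid M]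

/-- The product `f (m - 1) * ⋯ * f (k + 1) * f k`. -/
def descProd (f : ℕ → M) (m k : ℕ) : M := ((List.range (m - k)).map fun t => f (m - 1 - t)).prod

/-- The product `f k * f (k + 1) * ⋯ * f (m - 1)`. -/
def ascProd (f : ℕ → M) (m k : ℕ) : M := ((List.range (m - k)).map fun t => f (k + t)).prod

theorem prod_map_range_succ (f : ℕ → M) (n : ℕ) :
    ((List.range (n + 1)).map f).prod = ((List.range n).map f).prod * f n := by
  simp [List.range_succ]

theorem descProd_of_le (f : ℕ → M) {m k : ℕ} (h : m ≤ k) : descProd f m k = 1 := by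
  simp [descProd, Nat.sub_eq_zero_of_le h]

theorem descProd_succ (f : ℕ → M) {m k : ℕ} (h : k < m) :
    descProd f m k = descProd f m (k + 1) * f k := by
  rw [descProd, show m - k = (m - (k + 1)) + 1 by omega, prod_map_range_succ, descProd,
    show m - 1 - (m - (k + 1)) = k by omega]

theorem descProd_mul_descProd (f : ℕ → M) {m k j : ℕ} (hjk : j ≤ k) (hkm : k ≤ m) :
    descProd f m k * descProd f k j = descProd f m j := by
  induction hd : k - j generalizing j with
  | zero =>
    obtain rfl : k = j := by omega
    rw [descProd_of_le f le_rfl, mul_one]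
  | succ d ih =>
    rw [descProd_succ f (show j < k by omega), descProd_succ f (show j < m by omega), ← mul_assoc,
      ih (by omega) (by omega)]

theorem ascProd_succ (f : ℕ → M) {m k : ℕ} (h : k < m) :
    ascProd f m k = f k * ascProd f m (k + 1) := by
  rw [ascProd, show m - k = (m - (k + 1)) + 1 by omega, List.range_succ_eq_map]
  simp [ascProd, Function.comp_def, Nat.add_assoc, Nat.add_comm 1]

theorem ascProd_of_le (f : ℕ → M) {m k : ℕ} (h : m ≤ k) : ascProd f m k = 1 := by
  simp [ascProd, Nat.sub_eq_zero_of_le h]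

theorem commute_prod_map_range {x : M} {f : ℕ → M} {n : ℕ} (h : ∀ i < n, Commute x (f i)) :
    Commute x ((List.range n).map f).prod := by
  refine Commute.list_prod_right _ _ fun y hy => ?_
  obtain ⟨i, hi, rfl⟩ := List.mem_map.mp hy
  exact h i (List.mem_range.mp hi)

theorem commute_descProd {x : M} {f : ℕ → M} {m k : ℕ}
    (h : ∀ i, k ≤ i → i < m → Commute x (f i)) : Commute x (descProd f m k) :=
  commute_prod_map_range fun i hi => h _ (by omega) (by omega)

theorem commute_ascProd {x : M} {f : ℕ → M} {m k : ℕ}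
    (h : ∀ i, k ≤ i → i < m → Commute x (f i)) : Commute x (ascProd f m k) :=
  commute_prod_map_range fun i hi => h _ (by omega) (by omega)

/-- The abstract form of one passage: x travels from left to right, emits h' on crossing z, absorbs
h on crossing y, and commutes with the rest. -/
theorem scatter {x p z h' m h y s : M} (hp : Commute x p) (hz : x * z = z * h' * x)
    (hm : Commute x m) (hy : x * h * y = y * x) (hs : Commute x s) :
    x * (p * z * m * h * y * s) = p * z * h' * m * y * s * x := by
  calc x * (p * z * m * h * y * s) = (x * p) * z * m * h * y * s := by simp only [mul_assoc]
    _ = p * (x * z) * m * h * y * s := by rw [hp.eq]; simp only [mul_assoc]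
    _ = p * z * h' * (x * m) * h * y * s := by rw [hz]; simp only [mul_assoc]
    _ = p * z * h' * m * (x * h * y) * s := by rw [hm.eq]; simp only [mul_assoc]
    _ = p * z * h' * m * y * (x * s) := by rw [hy]; simp only [mul_assoc]
    _ = p * z * h' * m * y * s * x := by rw [hs.eq]; simp only [mul_assoc]

end OrderedProducts

/-! ### Bookkeeping of q-commutation exponents -/

section QComm

variable {R : Type*} [Ring R] [Algebra ℝ R]

/-- The elements `u` and `v` satisfy `u * v = q ^ n * v * u`. -/
def IsQComm (q : ℝ) (n : ℤ) (u v : R) : Prop := u * v = q ^ n • (v * u)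

variable {q : ℝ} {m n : ℤ} {u u' v v' : R}

theorem isQComm_one_left : IsQComm q 0 (1 : R) v := by simp [IsQComm]

theorem isQComm_one_right : IsQComm q 0 u (1 : R) := by simp [IsQComm]

theorem IsQComm.mul_left (hq : q ≠ 0) (h : IsQComm q m u v) (h' : IsQComm q n u' v) :
    IsQComm q (m + n) (u * u') v := by
  rw [IsQComm] at *
  rw [mul_assoc, h', mul_smul_comm, ← mul_assoc, h, smul_mul_assoc, smul_smul, mul_assoc,
    zpow_add₀ hq, mul_comm (q ^ m)]

theorem IsQComm.mul_right (hq : q ≠ 0) (h : IsQComm q m u v) (h' : IsQComm q n u v') :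
    IsQComm q (m + n) u (v * v') := by
  rw [IsQComm] at *
  rw [← mul_assoc, h, smul_mul_assoc, mul_assoc, h', mul_smul_comm, smul_smul, mul_assoc,
    zpow_add₀ hq]

theorem IsQComm.commute (h : IsQComm q 0 u v) : Commute u v := by
  rw [IsQComm, zpow_zero, one_smul] at h
  exact h

end QComm

/-! ### Rows, columns and hooks in the triangle -/

section Nodes

/-- The generator `Z_{x + 1, x + y + 2}`, or `1` if that is not a vertex of the quiver. -/
noncomputable def node (q : ℝ) (N x y : ℕ) : TAlg q N :=
  if h : x + y + 2 ≤ N then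
    Z q ⟨(x + 1, x + y + 2), Nat.le_add_left 1 x, show x + 1 < x + y + 2 by omega, h⟩
  else 1

/-- The product of the nodes `(a, y), (a + 1, y), …, (a + l - 1, y)`. -/
noncomputable def row (q : ℝ) (N a y l : ℕ) : TAlg q N :=
  ((List.range l).map fun k => node q N (a + k) y).prod

/-- The product of the nodes `(a, n - 2 - a), …, (a, y + 1), (a, y)`. -/
noncomputable def col (q : ℝ) (N n a y : ℕ) : TAlg q N := descProd (node q N a) (n - 1 - a) y

/-- The matrix of the quiver in the coordinates of `node`. -/
def nodeForm (x y x' y' : ℕ) : ℤ :=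
  if (x' = x ∧ y' = y + 1) ∨ (x' = x + 1 ∧ y' + 1 = y) ∨ (x' + 1 = x ∧ y' = y) then 1
  else if (x = x' ∧ y = y' + 1) ∨ (x = x' + 1 ∧ y + 1 = y') ∨ (x + 1 = x' ∧ y = y') then -1
  else 0

variable {q : ℝ} {N : ℕ}

theorem node_isQComm {x y x' y' : ℕ} (h : x + y + 2 ≤ N) (h' : x' + y' + 2 ≤ N) :
    IsQComm q (nodeForm x y x' y') (node q N x y) (node q N x' y') := by
  rw [node, dif_pos h, node, dif_pos h', IsQComm, Z, Z, gen_mul_gen]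
  congr 2
  unfold incidence nodeForm Edge
  simp only [Prod.mk.injEq]
  refine if_congr (by omega) rfl (if_congr (by omega) rfl rfl)

theorem node_mem_augIdeal {x y : ℕ} (h : x + y + 2 ≤ N) :
    node q N x y ∈ augIdeal q (incidence N) := by
  rw [node, dif_pos h]
  exact constTerm_gen q (incidence N) _

theorem row_zero (a y : ℕ) : row q N a y 0 = 1 := rfl

theorem row_succ (a y l : ℕ) : row q N a y (l + 1) = row q N a y l * node q N (a + l) y :=
  prod_map_range_succ _ _

theorem row_mem_augIdeal {a y l : ℕ} (h : a + l + y + 2 ≤ N) :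
    row q N a y (l + 1) ∈ augIdeal q (incidence N) := by
  rw [row_succ]
  exact Ideal.mul_mem_left _ _ (node_mem_augIdeal h)

theorem col_of_le {n a y : ℕ} (h : n ≤ a + y + 1) : col q N n a y = 1 :=
  descProd_of_le _ (by omega)

theorem col_eq {n a y : ℕ} (h : a + y + 2 ≤ n) :
    col q N n a y = col q N n a (y + 1) * node q N a y :=
  descProd_succ _ (by omega)

theorem col_mem_augIdeal {n a y : ℕ} (hn : n ≤ N) (h : a + y + 2 ≤ n) :
    col q N n a y ∈ augIdeal q (incidence N) := by
  rw [col_eq h]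
  exact Ideal.mul_mem_left _ _ (node_mem_augIdeal (by omega))

/-- The contributions of the column's nodes cancel in pairs, so only its lower end can matter. The
hypothesis `hx` excludes an uncancelled term at the upper end, which occurs for a node on the
hypotenuse and a column not to its left. -/
theorem node_isQComm_col (hq : q ≠ 0) {n x y a b : ℕ} (hn : n ≤ N) (hxy : x + y + 2 ≤ n)
    (hx : x + y + 3 ≤ n ∨ a < x) (hab : a + b + 1 ≤ n) :
    IsQComm q ((if x = a ∧ (b = y ∨ b = y + 1) then 1 else 0) -
      (if (x + 1 = a ∧ b = y) ∨ (x = a + 1 ∧ b = y + 1) then 1 else 0))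
      (node q N x y) (col q N n a b) := by
  induction hd : n - (a + b + 1) generalizing b with
  | zero =>
    rw [col_of_le (by omega), if_neg (by omega), if_neg (by omega)]
    exact isQComm_one_right
  | succ d ih =>
    rw [col_eq (by omega)]
    have h := (ih (b := b + 1) (by omega) (by omega)).mul_right hq
      (node_isQComm (q := q) (N := N) (x := x) (y := y) (x' := a) (y' := b) (by omega) (by omega))
    convert h using 1
    unfold nodeForm
    grind

/-- The exponents telescope along the row, leaving only its right end. The two exceptional columns
start just above the last node and just to its right; they are where hooks are created and absorbed.
-/
theorem row_isQComm_col (hq : q ≠ 0) {n a y l a' b : ℕ} (hn : n ≤ N) (hl : a + l + y + 2 ≤ n)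
    (ha : a ≤ a') (hy : a = a' → y < b) (hab : a' + b + 1 ≤ n) :
    IsQComm q (if a' + 1 = a + l ∧ b = y + 1 then 1 else if a' = a + l ∧ b = y then -1 else 0)
      (row q N a y l) (col q N n a' b) := by
  induction l with
  | zero =>
    rw [if_neg (by omega), if_neg (by omega), row_zero]
    exact isQComm_one_left
  | succ l ih =>
    rw [row_succ]
    have h := (ih (by omega)).mul_left hq
      (node_isQComm_col hq (x := a + l) (y := y) hn (by omega) (Or.inl (by omega)) hab)
    convert h using 1
    grind

/-- A row that ends at the boundary commutes with the columns that do not meet its end. -/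
theorem full_row_commute_col (hq : q ≠ 0) {n a y l a' b : ℕ} (hn : n ≤ N)
    (hl : a + l + y + 2 = n) (ha : a ≤ a') (ha' : a' < a + l) (hy : a = a' → y < b)
    (hab : a' + b + 1 ≤ n) : Commute (row q N a y (l + 1)) (col q N n a' b) := by
  rw [row_succ]
  have h := (row_isQComm_col hq hn (by omega : a + l + y + 2 ≤ n) ha hy hab).mul_left hq
      (node_isQComm_col hq (x := a + l) (y := y) hn (by omega) (Or.inr ha') hab)
  refine IsQComm.commute (q := q) ?_
  convert h using 1
  grind

/-- The product of the nodes `(a, y), …, (a + l - 1, y)` and the column above `(a + l, y)`. -/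
noncomputable def hook (q : ℝ) (N n a y l : ℕ) : TAlg q N := row q N a y l * col q N n (a + l) y

theorem hook_zero (n a y : ℕ) : hook q N n a y 0 = col q N n a y := by
  rw [hook, row_zero, one_mul, add_zero]

theorem hook_last {n a y l : ℕ} (h : a + l + y + 2 = n) :
    hook q N n a y l = row q N a y (l + 1) := by
  rw [hook, row_succ, col_eq (by omega), col_of_le (by omega), one_mul]

/-- The row without its last node commutes with the column, and that last node then extends the
column downwards. -/
theorem col_mul_row (hq : q ≠ 0) {n a y l : ℕ} (hn : n ≤ N) (hl : a + l + y + 2 ≤ n) :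
    col q N n (a + l) (y + 1) * row q N a y (l + 1) = hook q N n a y l := by
  have h := row_isQComm_col hq hn hl (Nat.le_add_right a l) (fun _ => Nat.lt_succ_self y)
    (by omega : a + l + (y + 1) + 1 ≤ n)
  rw [if_neg (by omega), if_neg (by omega)] at h
  rw [row_succ, ← mul_assoc, ← h.commute.eq, mul_assoc, ← col_eq (by omega), hook]

/-- The pentagon with the column as x and the row as y, read from right to left. -/
theorem qExp_row_create (hq0 : 0 < q) (hq1 : q < 1) {n a y l : ℕ} (hn : n ≤ N)
    (hl : a + l + y + 3 ≤ n) :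
    qExp (row q N a y (l + 1)) * qExp (col q N n (a + l) (y + 1)) =
      qExp (col q N n (a + l) (y + 1)) * qExp (hook q N n a y l) *
        qExp (row q N a y (l + 1)) := by
  rw [← col_mul_row hq0.ne' hn (by omega)]
  refine (qExp_pentagon hq0 hq1 (col_mem_augIdeal hn (by omega)) (row_mem_augIdeal (by omega))
    ?_).symm
  have h := row_isQComm_col hq0.ne' hn (by omega : a + (l + 1) + y + 2 ≤ n)
    (Nat.le_add_right a l) (fun _ => Nat.lt_succ_self y) (by omega : a + l + (y + 1) + 1 ≤ n)
  rw [if_pos (by omega), IsQComm, zpow_one] at h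
  exact h

/-- The pentagon with the roles exchanged: the row is x and the column is y, since the exponent is
now -1. The product xy is the hook by definition. -/
theorem qExp_row_annihilate (hq0 : 0 < q) (hq1 : q < 1) {n a y l : ℕ} (hn : n ≤ N)
    (hl : a + l + y + 3 ≤ n) :
    qExp (row q N a y (l + 1)) * qExp (hook q N n a y (l + 1)) *
        qExp (col q N n (a + (l + 1)) y) =
      qExp (col q N n (a + (l + 1)) y) * qExp (row q N a y (l + 1)) := by
  refine qExp_pentagon hq0 hq1 (row_mem_augIdeal (by omega)) (col_mem_augIdeal hn (by omega)) ?_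
  have h := row_isQComm_col hq0.ne' hn (by omega : a + (l + 1) + y + 2 ≤ n)
    (Nat.le_add_right a (l + 1)) (by omega) (by omega : a + (l + 1) + y + 1 ≤ n)
  rw [if_neg (by omega), if_pos (by omega), IsQComm, zpow_neg, zpow_one] at h
  rw [h, smul_smul, mul_inv_cancel₀ hq0.ne', one_smul]

theorem qExp_row_commute (hq : q ≠ 0) {n a y l a' b : ℕ} (hn : n ≤ N) (hl : a + l + y + 3 ≤ n)
    (ha : a ≤ a') (hy : a = a' → y < b) (hab : a' + b + 2 ≤ n)
    (h1 : ¬ (a' = a + l ∧ b = y + 1)) (h2 : ¬ (a' = a + (l + 1) ∧ b = y)) :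
    Commute (qExp (row q N a y (l + 1))) (qExp (col q N n a' b)) := by
  refine commute_qExp (IsQComm.commute (q := q) ?_)
  have h := row_isQComm_col hq hn (by omega : a + (l + 1) + y + 2 ≤ n) ha hy
    (by omega : a' + b + 1 ≤ n)
  rwa [if_neg (by omega), if_neg (by omega)] at h

end Nodes

/-! ### Moving rows through the columns -/

section Scattering

/-- The ordered product of the quantum exponentials of the columns above `(a, y'), y ≤ y'`. -/
noncomputable def colGroup (q : ℝ) (N n a y : ℕ) : TSeries q N :=
  descProd (fun b => qExp (col q N n a b)) (n - 1 - a) y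

/-- The ordered product of the quantum exponentials of the columns above `(a', y'), a ≤ a'`. -/
noncomputable def colSuffix (q : ℝ) (N n a : ℕ) : TSeries q N :=
  ascProd (fun a' => colGroup q N n a' 0) n a

/-- The columns above `(a, y'), y < y'`, followed by those above `(a', y')`,
`a < a' < a + l`. -/
noncomputable def colPrefix (q : ℝ) (N n a y l : ℕ) : TSeries q N :=
  ((List.range l).map fun k => colGroup q N n (a + k) (if k = 0 then y + 1 else 0)).prod

/-- The columns above `(a + l, y'), y' ≤ y`, or nothing if `l = 0`. -/
noncomputable def colLower (q : ℝ) (N n a y l : ℕ) : TSeries q N :=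
  if l = 0 then 1 else descProd (fun b => qExp (col q N n (a + l) b)) (y + 1) 0

/-- The columns after `(a, y)` with the quantum exponential of a hook inserted. -/
noncomputable def withHook (q : ℝ) (N n a y l : ℕ) : TSeries q N :=
  colPrefix q N n a y l * colGroup q N n (a + l) (y + 1) * qExp (hook q N n a y l) *
    colLower q N n a y l * colSuffix q N n (a + l + 1)

variable {q : ℝ} {N : ℕ}

theorem colGroup_eq {n a y : ℕ} (h : a + y + 2 ≤ n) :
    colGroup q N n a y = colGroup q N n a (y + 1) * qExp (col q N n a y) :=
  descProd_succ _ (by omega)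

theorem colGroup_of_le {n a y : ℕ} (h : n ≤ a + y + 1) : colGroup q N n a y = 1 :=
  descProd_of_le _ (by omega)

theorem colSuffix_eq {n a : ℕ} (h : a < n) :
    colSuffix q N n a = colGroup q N n a 0 * colSuffix q N n (a + 1) :=
  ascProd_succ _ h

theorem colSuffix_of_le {n a : ℕ} (h : n ≤ a) : colSuffix q N n a = 1 :=
  ascProd_of_le _ h

theorem colGroup_mul_colLower {n a y l : ℕ} (h : a + l + y + 2 ≤ n) :
    colGroup q N n (a + l) (y + 1) * colLower q N n a y l =
      colGroup q N n (a + l) (if l = 0 then y + 1 else 0) := by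
  unfold colLower
  split_ifs
  · rw [mul_one]
  · exact descProd_mul_descProd _ (by omega) (by omega)

theorem colPrefix_succ {n a y l : ℕ} (h : a + l + y + 2 ≤ n) :
    colPrefix q N n a y (l + 1) =
      colPrefix q N n a y l * (colGroup q N n (a + l) (y + 1) * colLower q N n a y l) := by
  rw [colGroup_mul_colLower h]
  exact prod_map_range_succ _ _

/-- Splits the columns after (a, y) at the slot where the hook with horizontal part of length l is
inserted, between the columns above (a + l, y + 1) and (a + l, y). For l = 0 the latter is not yet
in the product. -/
theorem colGroup_mul_colSuffix {n a y l : ℕ} (h : a + l + y + 2 ≤ n) :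
    colGroup q N n a (y + 1) * colSuffix q N n (a + 1) =
      colPrefix q N n a y l * (colGroup q N n (a + l) (y + 1) * colLower q N n a y l) *
        colSuffix q N n (a + l + 1) := by
  induction l with
  | zero => simp [colPrefix, colLower]
  | succ l ih =>
    rw [ih (by omega), colSuffix_eq (show a + l + 1 < n by omega), colPrefix_succ (by omega)]
    have e := colGroup_mul_colLower (q := q) (N := N) (n := n) (a := a) (y := y) (l := l + 1)
      (by omega)
    rw [if_neg (Nat.succ_ne_zero l)] at e
    rw [e]
    simp only [mul_assoc, add_assoc]

theorem withHook_zero {n a y : ℕ} (h : a + y + 2 ≤ n) :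
    withHook q N n a y 0 = colGroup q N n a y * colSuffix q N n (a + 1) := by
  rw [colGroup_eq h, withHook, hook_zero]
  simp [colPrefix, colLower]

/-- The longest row ends on the hypotenuse, where the column above its end is a single node, so it
is already a hook. It commutes with every column that precedes its slot. -/
theorem withHook_last (hq : q ≠ 0) {n a y l : ℕ} (hn : n ≤ N) (h : a + l + y + 2 = n) :
    qExp (row q N a y (l + 1)) * (colGroup q N n a (y + 1) * colSuffix q N n (a + 1)) =
      withHook q N n a y l := by
  have hc : Commute (qExp (row q N a y (l + 1))) (colPrefix q N n a y l) := by
    refine commute_prod_map_range fun k hk => commute_descProd fun b hb hb' => commute_qExp ?_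
    refine full_row_commute_col hq hn h (by omega) (by omega) (fun e => ?_) (by omega)
    rw [if_pos (by omega)] at hb
    omega
  rw [colGroup_mul_colSuffix h.le, withHook, hook_last h, colGroup_of_le (by omega), one_mul,
    mul_one, ← mul_assoc, ← mul_assoc, hc.eq]

theorem row_mul_withHook (hq0 : 0 < q) (hq1 : q < 1) {n a y l : ℕ} (hn : n ≤ N)
    (h : a + l + y + 3 ≤ n) :
    qExp (row q N a y (l + 1)) * withHook q N n a y (l + 1) =
      withHook q N n a y l * qExp (row q N a y (l + 1)) := by
  have comm := @qExp_row_commute q N hq0.ne' n a y l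
  have hlow : colLower q N n a y (l + 1) = qExp (col q N n (a + (l + 1)) y) *
      descProd (fun b => qExp (col q N n (a + (l + 1)) b)) y 0 := by
    rw [colLower, if_neg (Nat.succ_ne_zero l),
      ← descProd_mul_descProd _ (Nat.zero_le y) (Nat.le_succ y), descProd_succ _ (Nat.lt_succ_self y),
      descProd_of_le _ le_rfl, one_mul]
  -- The travelling row meets z = E(column above its last node), emits the shorter hook, and then
  -- meets the old hook next to E(column to the right of its end), which absorbs it.
  have key := scatter
    (x := qExp (row q N a y (l + 1)))
    (p := colPrefix q N n a y l * colGroup q N n (a + l) (y + 2))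
    (z := qExp (col q N n (a + l) (y + 1))) (h' := qExp (hook q N n a y l))
    (m := colLower q N n a y l * colGroup q N n (a + (l + 1)) (y + 1))
    (h := qExp (hook q N n a y (l + 1))) (y := qExp (col q N n (a + (l + 1)) y))
    (s := descProd (fun b => qExp (col q N n (a + (l + 1)) b)) y 0 *
      colSuffix q N n (a + (l + 1) + 1))
    ?_ (qExp_row_create hq0 hq1 hn h) ?_ (qExp_row_annihilate hq0 hq1 hn h) ?_
  · rw [withHook, withHook, colPrefix_succ (by omega), hlow,
      colGroup_eq (show a + l + (y + 1) + 2 ≤ n by omega)]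
    rw [add_assoc a l 1, colSuffix_eq (show a + (l + 1) < n by omega)]
    have e := colGroup_mul_colLower (q := q) (N := N) (n := n) (a := a) (y := y) (l := l + 1)
      (by omega)
    rw [if_neg (Nat.succ_ne_zero l), hlow] at e
    rw [← e]
    simp only [mul_assoc] at key ⊢
    exact key
  · refine Commute.mul_right (commute_prod_map_range fun k hk => ?_) ?_
    · refine commute_descProd fun b hb hb' => comm hn h (by omega) (fun e => ?_) (by omega)
        (by omega) (by omega)
      rw [if_pos (by omega)] at hb
      omega
    · exact commute_descProd fun b hb hb' => comm hn h (by omega) (by omega) (by omega)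
        (by omega) (by omega)
  · refine Commute.mul_right ?_ ?_
    · unfold colLower
      split_ifs
      · exact Commute.one_right _
      · exact commute_descProd fun b hb hb' => comm hn h (by omega) (by omega) (by omega)
          (by omega) (by omega)
    · exact commute_descProd fun b hb hb' => comm hn h (by omega) (by omega) (by omega)
        (by omega) (by omega)
  · refine Commute.mul_right ?_ ?_
    · exact commute_descProd fun b hb hb' => comm hn h (by omega) (by omega) (by omega)
        (by omega) (by omega)
    · exact commute_ascProd fun i hi hi' => commute_descProd fun b hb hb' =>
        comm hn h (by omega) (by omega) (by omega) (by omega) (by omega)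

/-- The ordered product of the quantum exponentials of the rows that begin at `(a, y)` inside
the triangle of size `n`. -/
noncomputable def rowBlock (q : ℝ) (N n a y : ℕ) : TSeries q N :=
  ((List.range (n - 1 - a - y)).map fun l => qExp (row q N a y (l + 1))).prod

/-- The ordered product of the quantum exponentials of all rows inside the triangle of size
`n`. -/
noncomputable def rowProd (q : ℝ) (N n : ℕ) : TSeries q N :=
  ((List.range N).map fun a => ((List.range N).map fun y => rowBlock q N n a y).prod).prod

theorem rows_mul_withHook (hq0 : 0 < q) (hq1 : q < 1) {n a y l : ℕ} (hn : n ≤ N)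
    (h : a + l + y + 2 ≤ n) :
    ((List.range l).map fun l => qExp (row q N a y (l + 1))).prod * withHook q N n a y l =
      withHook q N n a y 0 * ((List.range l).map fun l => qExp (row q N a y (l + 1))).prod := by
  induction l with
  | zero => simp
  | succ l ih =>
    rw [prod_map_range_succ, mul_assoc, row_mul_withHook hq0 hq1 hn (by omega), ← mul_assoc,
      ih (by omega), mul_assoc]

/-- The longest row enters as a hook and is converted by the shorter rows into the column above (a,
y). Those shorter rows are exactly the block for the triangle of size n - 1. -/
theorem rowBlock_mul (hq0 : 0 < q) (hq1 : q < 1) {n : ℕ} (hn : n ≤ N) (a y : ℕ) :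
    rowBlock q N n a y * (colGroup q N n a (y + 1) * colSuffix q N n (a + 1)) =
      colGroup q N n a y * colSuffix q N n (a + 1) * rowBlock q N (n - 1) a y := by
  by_cases h : a + y + 2 ≤ n
  · obtain ⟨l, hl⟩ : ∃ l, a + l + y + 2 = n := ⟨n - (a + y + 2), by omega⟩
    rw [rowBlock, rowBlock, show n - 1 - a - y = l + 1 by omega,
      show n - 1 - 1 - a - y = l by omega, prod_map_range_succ, mul_assoc,
      withHook_last hq0.ne' hn hl, rows_mul_withHook hq0 hq1 hn hl.le, withHook_zero h]
  · rw [rowBlock, rowBlock, show n - 1 - a - y = 0 by omega, show n - 1 - 1 - a - y = 0 by omega,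
      colGroup_of_le (by omega), colGroup_of_le (by omega)]
    simp

theorem prod_mul_shift {M : Type*} [Monoid M] {f g s : ℕ → M}
    (h : ∀ i, f i * s (i + 1) = s i * g i) (m : ℕ) :
    ((List.range m).map f).prod * s m = s 0 * ((List.range m).map g).prod := by
  induction m with
  | zero => simp
  | succ m ih =>
    rw [prod_map_range_succ, prod_map_range_succ, mul_assoc, h, ← mul_assoc, ih, mul_assoc]

/-- Telescoping first over y and then over a: the accumulated columns start empty at the right end
of the product of rows and are complete at its left end. -/
theorem rowProd_eq (hq0 : 0 < q) (hq1 : q < 1) {n : ℕ} (hn : n ≤ N) :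
    rowProd q N n = colSuffix q N n 0 * rowProd q N (n - 1) := by
  have h := prod_mul_shift
    (f := fun a => ((List.range N).map fun y => rowBlock q N n a y).prod)
    (g := fun a => ((List.range N).map fun y => rowBlock q N (n - 1) a y).prod)
    (s := colSuffix q N n) (fun a => ?_) N
  · rwa [colSuffix_of_le hn, mul_one] at h
  · have h := prod_mul_shift
      (s := fun y => colGroup q N n a y * colSuffix q N n (a + 1))
      (fun y => rowBlock_mul hq0 hq1 hn a y) N
    rw [colGroup_of_le (by omega), one_mul] at h
    rw [h]
    by_cases ha : a < n
    · rw [← colSuffix_eq ha]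
    · rw [colGroup_of_le (by omega), colSuffix_of_le (by omega), colSuffix_of_le (by omega),
        one_mul]

theorem rowProd_eq_prod_colSuffix (hq0 : 0 < q) (hq1 : q < 1) {n : ℕ} (hn : n ≤ N) :
    rowProd q N n = ((List.range n).map fun a => colSuffix q N (n - a) 0).prod := by
  induction n with
  | zero => simp [rowProd, rowBlock]
  | succ n ih =>
    rw [rowProd_eq hq0 hq1 hn, Nat.add_sub_cancel, ih (by omega), List.range_succ_eq_map]
    simp [Function.comp_def, Nat.add_sub_add_right]

end Scattering


/-! ### Lexicographic products over the tetrahedron as nested products -/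

section Tetrahedron

theorem prod_map_range_trim {M : Type*} [Monoid M] {f : ℕ → M} {n k m : ℕ} (h : k + m ≤ n)
    (hl : ∀ i < k, f i = 1) (hr : ∀ i, k + m ≤ i → f i = 1) :
    ((List.range n).map f).prod = ((List.range m).map fun i => f (k + i)).prod := by
  obtain ⟨d, rfl⟩ := Nat.exists_eq_add_of_le h
  have one : ∀ (g : ℕ → M) (j : ℕ), (∀ i < j, g i = 1) → ((List.range j).map g).prod = 1 :=
    fun g j hg => List.prod_eq_one fun x hx => by
      obtain ⟨i, hi, rfl⟩ := List.mem_map.mp hx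
      exact hg i (List.mem_range.mp hi)
  rw [List.range_add, List.map_append, List.prod_append, List.range_add, List.map_append,
    List.prod_append, one f k hl, one_mul, List.map_map, List.map_map,
    one (f ∘ _) d fun i _ => hr _ (by omega), mul_one]
  rfl

theorem prod_map_range_congr {M : Type*} [Monoid M] {f g : ℕ → M} {n : ℕ}
    (h : ∀ i < n, f i = g i) : ((List.range n).map f).prod = ((List.range n).map g).prod :=
  congrArg List.prod (List.map_congr_left fun i hi => h i (List.mem_range.mp hi))

theorem prod_map_filterMap_dite {M α : Type*} [Monoid M] {p : α → Prop} [DecidablePred p]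
    (f : {t // p t} → M) (l : List α) :
    ((l.filterMap fun t => if h : p t then some (⟨t, h⟩ : {t // p t}) else none).map f).prod =
      (l.map fun t => if h : p t then f ⟨t, h⟩ else 1).prod := by
  induction l with
  | nil => rfl
  | cons t l ih =>
    by_cases h : p t
    · simp [h, ih]
    · simp [h, ih]

theorem prod_map_product {M α β : Type*} [Monoid M] (f : α × β → M) (l : List α) (l' : List β) :
    ((l ×ˢ l').map f).prod = (l.map fun a => (l'.map fun b => f (a, b)).prod).prod := by
  induction l with
  | nil => simp
  | cons a l ih => simp [List.product_cons, ih, Function.comp_def]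

theorem prod_map_tetraList {M : Type*} [Monoid M] {N : ℕ} (f : Tetra N → M) (g : ℕ → ℕ → ℕ → M)
    (h : ∀ (a y l : ℕ) (ht : _), f ⟨(a + 1, a + y + 2, a + y + l + 3), ht⟩ = g a y l) :
    ((tetraList N).map f).prod = ((List.range N).map fun a => ((List.range (N - a)).map fun y =>
      ((List.range (N - 1 - a - y)).map fun l => g a y l).prod).prod).prod := by
  rw [tetraList, prod_map_filterMap_dite, prod_map_product]
  simp only [prod_map_product]
  have triv : ∀ n : ℕ, ((List.range n).map fun _ => (1 : M)).prod = 1 := by simp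
  -- The offsets 1, a + 2 and a + y + 3 discard the indices that violate 1 ≤ a < b < c ≤ N + 1. For
  -- the last y the innermost range is empty.
  rw [prod_map_range_trim (k := 1) (m := N) (by omega)]
  · refine prod_map_range_congr fun a ha => ?_
    rw [prod_map_range_trim (k := a + 2) (m := N - a) (by omega)]
    · refine prod_map_range_congr fun y hy => ?_
      rw [prod_map_range_trim (k := a + y + 3) (m := N - 1 - a - y) (by omega)]
      · refine prod_map_range_congr fun l hl => ?_
        rw [dif_pos (by omega)]
        rw [← h a y l (by dsimp only; omega)]
        congr 2
        simp only [Prod.mk.injEq]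
        omega
      · intro c hc
        rw [dif_neg (by omega)]
      · intro c hc
        rw [dif_neg (by omega)]
    · intro b hb
      exact (prod_map_range_congr fun c _ => dif_neg (by omega)).trans (triv _)
    · intro b hb
      exact (prod_map_range_congr fun c _ => dif_neg (by omega)).trans (triv _)
  · intro a ha
    refine (prod_map_range_congr fun b _ => ?_).trans (triv _)
    exact (prod_map_range_congr fun c _ => dif_neg (by omega)).trans (triv _)
  · intro a ha
    refine (prod_map_range_congr fun b _ => ?_).trans (triv _)
    exact (prod_map_range_congr fun c _ => dif_neg (by omega)).trans (triv _)

theorem prod_map_diag {M : Type*} [Monoid M] {N : ℕ} (t : Tetra N) (f : Vertex N → M) (g : ℕ → M)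
    {n : ℕ} (hn : t.1.2.2 - t.1.2.1 = n)
    (h : ∀ (k : ℕ) (hv : _), k < n → f ⟨(t.1.1 + k, t.1.2.1 + k), hv⟩ = g k) :
    ((diag t).map f).prod = ((List.range n).map g).prod := by
  subst hn
  rw [diag, List.map_map, ← List.map_coe_finRange_eq_range, List.map_map]
  refine congrArg List.prod (List.map_congr_left fun k _ => ?_)
  exact h k _ k.2

end Tetrahedron

/-! ### Rotation turns rows into columns -/

section Rotation

variable {q : ℝ} {N : ℕ}

theorem node_of_eq {x y : ℕ} (v : Vertex N) (h1 : v.1.1 = x + 1) (h2 : v.1.2 = x + y + 2) :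
    Z q v = node q N x y := by
  have := v.2
  rw [node, dif_pos (by omega)]
  exact congrArg _ (Subtype.ext (Prod.ext h1 h2))

theorem rho_iterate_dil (m : ℕ) (t : Tetra N) :
    (rho q N)^[m] (dil q t) = qExp ((diag t).map fun v => Z q (rotVertex^[m] v)).prod := by
  induction m with
  | zero => rfl
  | succ m ih =>
    rw [Function.iterate_succ_apply', ih, rho, relabelSeries_qExp, map_list_prod, List.map_map]
    simp only [Function.comp_def, Z, relabel_gen, Function.iterate_succ_apply']

theorem cyclicT_eq : cyclicT q N = rowProd q N N := by
  rw [cyclicT, prod_map_tetraList (dil q) fun a y l => qExp (row q N a y (l + 1))]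
  · refine prod_map_range_congr fun a ha => ?_
    rw [prod_map_range_trim (n := N) (k := 0) (m := N - a) (by omega)]
    · simp only [zero_add]
      rfl
    · omega
    · intro y hy
      rw [rowBlock, show N - 1 - a - y = 0 by omega]
      rfl
  · intro a y l ht
    dsimp only at ht
    rw [dil, row]
    congr 1
    exact prod_map_diag _ _ _ (by dsimp only; omega)
      fun k hv hk => node_of_eq _ (by dsimp only; omega) (by dsimp only; omega)

/-- The rotation sends the point (x, y) to (y, N - 2 - x - y). So the row from (a, y) becomes a
column in position y that descends from the hypotenuse of the triangle of size N - a, and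
lexicographic order becomes the order used in `colSuffix`. -/
theorem rho_cyclicT_eq :
    rho q N (cyclicT q N) = ((List.range N).map fun a => colSuffix q N (N - a) 0).prod := by
  rw [cyclicT, map_list_prod, List.map_map,
    prod_map_tetraList _ fun a y l => qExp (col q N (N - a) y (N - a - 2 - y - l))]
  · refine prod_map_range_congr fun a ha => prod_map_range_congr fun y hy => ?_
    change _ = colGroup q N (N - a) (0 + y) 0
    rw [zero_add, colGroup, descProd, show N - a - 1 - y - 0 = N - 1 - a - y by omega]
    refine prod_map_range_congr fun l hl => ?_
    rw [show N - a - 1 - y - 1 - l = N - a - 2 - y - l by omega]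
  · intro a y l ht
    dsimp only at ht
    refine (rho_iterate_dil 1 _).trans ?_
    rw [col, descProd, show N - a - 1 - y - (N - a - 2 - y - l) = l + 1 by omega]
    congr 1
    refine prod_map_diag _ _ _ (by dsimp only; omega) fun k hv hk => node_of_eq _ ?_ ?_
    · simp only [Function.iterate_one, rotVertex]
      omega
    · simp only [Function.iterate_one, rotVertex]
      omega

theorem rho_cyclicT (hq0 : 0 < q) (hq1 : q < 1) : rho q N (cyclicT q N) = cyclicT q N := by
  rw [rho_cyclicT_eq, cyclicT_eq, rowProd_eq_prod_colSuffix hq0 hq1 le_rfl]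

end Rotation

/-! ### Reduction by killing generators -/

section Reduction

variable {q : ℝ} {N : ℕ}

open Classical in
/-- The endomorphism that sends `Z_v` to `0` for `v ∈ I` and fixes the other generators. -/
noncomputable def killGens {V : Type*} (q : ℝ) (B : V → V → ℤ) (I : Set V) :
    QAlg q B →ₐ[ℝ] QAlg q B :=
  liftQ q B (fun v => if v ∈ I then 0 else gen q B v) fun v w => by
    by_cases hv : v ∈ I
    · simp [hv]
    · by_cases hw : w ∈ I
      · simp [hw]
      · simpa [hv, hw] using gen_mul_gen q B v w

theorem killGens_of_mem {V : Type*} {B : V → V → ℤ} {I : Set V} {v : V} (hv : v ∈ I) :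
    killGens q B I (gen q B v) = 0 := by
  rw [killGens, liftQ_gen, if_pos hv]

theorem killGens_of_notMem {V : Type*} {B : V → V → ℤ} {I : Set V} {v : V} (hv : v ∉ I) :
    killGens q B I (gen q B v) = gen q B v := by
  rw [killGens, liftQ_gen, if_neg hv]

theorem constTerm_killGens {V : Type*} (B : V → V → ℤ) (I : Set V) (x : QAlg q B) :
    constTerm q B (killGens q B I x) = constTerm q B x := by
  have h : (constTerm q B).comp (killGens q B I) = constTerm q B := by
    refine hom_ext q B fun v => ?_
    rw [AlgHom.comp_apply, constTerm_gen]
    by_cases hv : v ∈ I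
    · rw [killGens_of_mem hv, map_zero]
    · rw [killGens_of_notMem hv, constTerm_gen]
  exact DFunLike.congr_fun h x

open Classical in
theorem reducedT_eq_prod_qExp (I : Set (Vertex N)) (m : ℕ) :
    reducedT q I m = ((tetraList N).map fun t => if ∃ v ∈ diag t, rotVertex^[m] v ∈ I then 1
      else qExp ((diag t).map fun v => Z q (rotVertex^[m] v)).prod).prod := by
  simp only [reducedT, rho_iterate_dil]

theorem reducedT_eq_mapSeries (I : Set (Vertex N)) (m : ℕ) :
    reducedT q I m =
      mapSeries (killGens q (incidence N) I) (constTerm_killGens _ I)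
        ((rho q N)^[m] (cyclicT q N)) := by
  rw [← reducedT_empty, reducedT_eq_prod_qExp, reducedT_eq_prod_qExp, map_list_prod, List.map_map]
  refine congrArg List.prod (List.map_congr_left fun t _ => ?_)
  simp only [Function.comp_apply, Set.mem_empty_iff_false, and_false, exists_false, if_false]
  rw [mapSeries_qExp, map_list_prod, List.map_map]
  split_ifs with h
  · obtain ⟨v, hv, hI⟩ := h
    -- One killed generator annihilates the whole monomial, and E(0) = 1 is the prescribed
    -- replacement.
    rw [List.prod_eq_zero, qExp_zero]
    exact List.mem_map.mpr ⟨v, hv, killGens_of_mem hI⟩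
  · push Not at h
    refine congrArg qExp (congrArg List.prod (List.map_congr_left fun v hv => ?_))
    exact (killGens_of_notMem (h v hv)).symm

theorem reducedT_eq_reducedT_zero (hq0 : 0 < q) (hq1 : q < 1) (I : Set (Vertex N)) (m : ℕ) :
    reducedT q I m = reducedT q I 0 := by
  rw [reducedT_eq_mapSeries, reducedT_eq_mapSeries]
  congr 1
  exact Function.iterate_fixed (rho_cyclicT hq0 hq1) m

end Reduction

/-! ### The case N = 3 -/

section SmallTriangle

variable {q : ℝ}

open Classical in
theorem reducedT_three (I : Set (Vertex 3)) (m : ℕ) :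
    reducedT q I m =
      (if rotVertex^[m] v12 ∈ I then 1 else qExp (Z q (rotVertex^[m] v12))) *
      (if rotVertex^[m] v12 ∈ I ∨ rotVertex^[m] v23 ∈ I then 1
        else qExp (Z q (rotVertex^[m] v12) * Z q (rotVertex^[m] v23))) *
      (if rotVertex^[m] v13 ∈ I then 1 else qExp (Z q (rotVertex^[m] v13))) *
      (if rotVertex^[m] v23 ∈ I then 1 else qExp (Z q (rotVertex^[m] v23))) := by
  have h : tetraList 3 = [⟨(1, 2, 3), by decide⟩, ⟨(1, 2, 4), by decide⟩, ⟨(1, 3, 4), by decide⟩,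
    ⟨(2, 3, 4), by decide⟩] := by decide
  have d1 : diag (⟨(1, 2, 3), by decide⟩ : Tetra 3) = [v12] := by decide
  have d2 : diag (⟨(1, 2, 4), by decide⟩ : Tetra 3) = [v12, v23] := by decide
  have d3 : diag (⟨(1, 3, 4), by decide⟩ : Tetra 3) = [v13] := by decide
  have d4 : diag (⟨(2, 3, 4), by decide⟩ : Tetra 3) = [v23] := by decide
  rw [reducedT_eq_prod_qExp, h]
  simp [d1, d2, d3, d4, mul_assoc, -Subtype.exists]

theorem rotVertex_v12 : rotVertex v12 = v13 := by decide

theorem rotVertex_v13 : rotVertex v13 = v23 := by decide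

theorem rotVertex_v23 : rotVertex v23 = v12 := by decide

end SmallTriangle

end CyclicDilog

theorem proposition1 (q : ℝ) (hq0 : 0 < q) (hq1 : q < 1) :
    -- the reduced cyclic identities, for every `N` and every set `I` of vertices
    (∀ N : ℕ, 2 ≤ N → ∀ I : Set (Vertex N),
      reducedT q I 0 = reducedT q I 1 ∧ reducedT q I 1 = reducedT q I 2) ∧
    -- the unreduced identity for `N = 3` is the `4 ∼ 4` identity
    (reducedT q (∅ : Set (Vertex 3)) 0 =
        qExp (Z q v12) * qExp (Z q v12 * Z q v23) * qExp (Z q v13) * qExp (Z q v23) ∧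
      reducedT q (∅ : Set (Vertex 3)) 1 =
        qExp (Z q v13) * qExp (Z q v13 * Z q v12) * qExp (Z q v23) * qExp (Z q v12) ∧
      reducedT q (∅ : Set (Vertex 3)) 2 =
        qExp (Z q v23) * qExp (Z q v23 * Z q v13) * qExp (Z q v12) * qExp (Z q v13)) ∧
    -- its reduction along `(1, 3)` has the form of the pentagon identity in `X = Z_{12}` and
    -- `Y = Z_{23}`, for which `Y X = q X Y`
    (Z q v23 * Z q v12 = q • (Z q v12 * Z q v23) ∧
      reducedT q {v13} 0 = qExp (Z q v12) * qExp (Z q v12 * Z q v23) * qExp (Z q v23) ∧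
      reducedT q {v13} 1 = qExp (Z q v23) * qExp (Z q v12) ∧
      reducedT q {v13} 2 = qExp (Z q v23) * qExp (Z q v12)) ∧
    -- the pentagon identity for two indeterminates subject only to `Y X = q X Y`
    (gen q planeMatrix 1 * gen q planeMatrix 0 = q • (gen q planeMatrix 0 * gen q planeMatrix 1) ∧
      qExp (gen q planeMatrix 0) * qExp (gen q planeMatrix 0 * gen q planeMatrix 1) *
          qExp (gen q planeMatrix 1) =
        qExp (gen q planeMatrix 1) * qExp (gen q planeMatrix 0)) := by
  have n12 : v12 ≠ v13 := by decide
  have n23 : v23 ≠ v13 := by decide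
  refine ⟨fun N _ I => ⟨?_, ?_⟩, ⟨?_, ?_, ?_⟩, ⟨?_, ?_, ?_, ?_⟩, ?_, ?_⟩
  · rw [reducedT_eq_reducedT_zero hq0 hq1 I 1]
  · rw [reducedT_eq_reducedT_zero hq0 hq1 I 1, reducedT_eq_reducedT_zero hq0 hq1 I 2]
  · simp [reducedT_three]
  · simp [reducedT_three, rotVertex_v12, rotVertex_v13, rotVertex_v23]
  · simp [reducedT_three, rotVertex_v12, rotVertex_v13, rotVertex_v23]
  · rw [Z, Z, gen_mul_gen, show incidence 3 v23 v12 = 1 by decide, zpow_one]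
  · simp [reducedT_three, n12, n23]
  · simp [reducedT_three, rotVertex_v12, rotVertex_v13, rotVertex_v23, n12, n23]
  · simp [reducedT_three, rotVertex_v12, rotVertex_v13, rotVertex_v23, n12, n23]
  · rw [gen_mul_gen, show planeMatrix 1 0 = 1 by decide, zpow_one]
  -- The identity in two free q-commuting indeterminates is taken directly from the general
  -- pentagon, not transported from the reduced N = 3 identity.
  · refine qExp_pentagon hq0 hq1 (constTerm_gen _ _ _) (constTerm_gen _ _ _) ?_
    rw [gen_mul_gen, show planeMatrix 1 0 = 1 by decide, zpow_one]
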